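/- Fix $0<p<1$. In the Bernoulli model a random series-parallel network (a directed multigraph with two distinguished nodes, the source and the sink) grows as follows. In step $1$ the network consists of a single edge from the source to the sink. In each step $n\ge 2$ one of the $n-1$ existing edges, say $(x,y)$, is chosen uniformly at random; then, independently of this choice and of the past, with probability $p$ it is doubled in parallel (a further edge $(x,y)$ is added), and with probability $1-p$ it is doubled serially (it is replaced by two edges $(x,z)$ and $(z,y)$, where $z$ is a new node). Let $D_n$ be the degree, counting parallel edges separately, of the source in the random network with $n$ edges so obtained. For every $n\ge 1$ the random variable $D_n$ takes values in $\{1,\dots,n\}$ almost surely, and $$\mathbb{P}\{D_n=m\}=\sum_{j=0}^{m-1}\binom{m-1}{j}(-1)^{n+j-1}\binom{p(j+1)-1}{n-1},\qquad 1\le m\le n,$$ where $\binom{x}{k}=x(x-1)\cdots(x-k+1)/k!$ for real $x$. Moreover there is exactly one probability distribution on $\mathbb{R}$, the Mittag-Leffler distribution with parameter $p$, all of whose moments exist and whose $r$-th moment is $r!/\Gamma(rp+1)$ for every integer $r\ge 0$; and, as $n\to\infty$, $D_n/n^p$ converges in distribution to a random variable with this distribution. The same statements hold when $D_n$ is the degree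 of the sink instead of the source. -/

import Mathlib

open MeasureTheory Filter Topology
open scoped Nat

/-- The nodes of a series-parallel network: the two poles and the inner nodes; `inner k` is the
node that is created (if there is one) in step `k` of the growth process. -/
inductive Node where
  | source : Node
  | sink : Node
  | inner : ℕ → Node
  deriving DecidableEq

/-- A directed multigraph on `Node` with `n` labelled edges. The edge with label `i + 1` is
`i : Fin n`; it is directed from `tail i` to `head i`. -/
structure Network (n : ℕ) where
  tail : Fin n → Node
  head : Fin n → Node

namespace Network

instance instMeasurableSpace (n : ℕ) : MeasurableSpace (Network n) := ⊤

/-- The network without edges. -/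
def empty : Network 0 where
  tail := Fin.elim0
  head := Fin.elim0

/-- The network consisting of a single edge from the source to the sink. -/
def single : Network 1 where
  tail := fun _ => Node.source
  head := fun _ => Node.sink

/-- Parallel doubling of the edge `j = (x, y)`: a further edge `(x, y)` is inserted, which gets
the new label. -/
def parallel {n : ℕ} (G : Network n) (j : Fin n) : Network (n + 1) where
  tail := Fin.snoc (α := fun _ => Node) G.tail (G.tail j)
  head := Fin.snoc (α := fun _ => Node) G.head (G.head j)

/-- Serial doubling of the edge `j = (x, y)`: it is replaced by the edges `(x, z)` and `(z, y)`,
where `z` is a new node, `(x, z)` keeps the label `j` and `(z, y)` gets the new label. -/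
def serial {n : ℕ} (G : Network n) (j : Fin n) : Network (n + 1) where
  tail := Fin.snoc (α := fun _ => Node) G.tail (Node.inner (n + 1))
  head := Fin.snoc (α := fun _ => Node) (Function.update G.head j (Node.inner (n + 1))) (G.head j)

/-- The degree of the node `v`: the number of edges leaving `v` plus the number of edges
entering `v`, where parallel edges are counted separately. -/
def degree {n : ℕ} (G : Network n) (v : Node) : ℕ :=
  (Finset.univ.filter fun i => G.tail i = v).card + (Finset.univ.filter fun i => G.head i = v).card

end Network

/-- The coin that shows `true` with probability `p` and `false` with probability `1 - p`. -/
noncomputable def coin (p : ℝ) (hp : p ∈ Set.Ioo (0 : ℝ) 1) : PMF Bool :=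
  PMF.ofFintype (fun b => if b then ENNReal.ofReal p else ENNReal.ofReal (1 - p)) (by
    have h0 : 0 ≤ p := hp.1.le
    have h1 : 0 ≤ 1 - p := sub_nonneg.2 hp.2.le
    simp [← ENNReal.ofReal_add h0 h1])

/-- The law of the random series-parallel network of size `n` (i.e. with `n` edges) in the
Bernoulli model: in step `1` one starts with a single edge from source to sink; in each further
step an edge is chosen uniformly at random, and it is doubled in a parallel way with
probability `p`, in a serial way with probability `1 - p`.
(The value at `n = 0` plays no role.) -/
noncomputable def bernoulliModel (p : ℝ) (hp : p ∈ Set.Ioo (0 : ℝ) 1) : (n : ℕ) → PMF (Network n)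
  | 0 => PMF.pure Network.empty
  | 1 => PMF.pure Network.single
  | n + 2 =>
    (bernoulliModel p hp (n + 1)).bind fun G =>
      (PMF.uniformOfFintype (Fin (n + 1))).bind fun j =>
        (coin p hp).map fun b =>
          if b then G.parallel j else G.serial j

/-- The probability measure `μ` on `ℝ` is a Mittag-Leffler distribution with parameter `p`: all its
integer moments exist, and the `r`-th one is `r! / Γ(r p + 1)` for every `r ≥ 0`. -/
def IsMittagLeffler (p : ℝ) (μ : ProbabilityMeasure ℝ) : Prop :=
  ∀ r : ℕ, Integrable (fun x : ℝ => x ^ r) (μ : Measure ℝ) ∧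
    ∫ x, x ^ r ∂(μ : Measure ℝ) = (r ! : ℝ) / Real.Gamma ((r : ℝ) * p + 1)

/-!
# The degrees of the poles of a random series-parallel network

Let `D n` be the degree of a pole (source or sink) in the Bernoulli model with `n` edges. A serial
doubling never changes the degree of a pole, and a parallel doubling of the edge `j` raises it by
one exactly if `j` ends there (`Network.degree_parallel`, `Network.degree_serial`). As the doubled
edge is uniformly distributed and no edge is a loop at a pole, `D n` is a Markov chain that moves
from `k` to `k + 1` with probability `p k / n` (`growthStep_degree`). The explicit formula for its
distribution solves the forward equation of this chain (`degreeProb_succ`, `degreeProb_eq_sum`).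

For the limit law, the rising factorial `k (k + 1) ⋯ (k + r - 1)` is an eigenfunction of the
transition with eigenvalue `1 + p r / n`, so that the `r`-th rising factorial moment of `D n` is
`r! ∏_{i < n} (1 + p r / i)`. Euler's limit formula for the Gamma function shows that the moments of
`D n / n ^ p` converge to `r! / Γ(r p + 1)` (`tendsto_integral_scaledDegree_pow`).

The rest is the method of moments. Second moments give tightness, hence weak limit points by
Prokhorov's theorem, and any weak limit point has the limiting moments (`hasMoments_of_tendsto`);
this yields existence of the Mittag-Leffler distribution. It is unique since `∑ t ^ r / Γ(r p + 1)`
converges for every `t` (`summable_pow_div_Gamma`), so that the moments determine the moment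
generating function on the whole complex plane (`eq_of_hasMoments`). Thus there is only one limit
point, which is convergence in distribution (`tendsto_of_tendsto_moments`).
-/

/-! ### The degree of a node under one growth step -/

namespace Network

variable {n : ℕ}

/-- The number of ends of the edge `j` that lie at `v`. -/
def ends (G : Network n) (v : Node) (j : Fin n) : ℕ :=
  (if G.tail j = v then 1 else 0) + (if G.head j = v then 1 else 0)

lemma degree_eq_sum_ends (G : Network n) (v : Node) : G.degree v = ∑ j, G.ends v j := by
  simp only [degree, ends, Finset.card_filter, Finset.sum_add_distrib]

lemma degree_parallel (G : Network n) (j : Fin n) (v : Node) :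
    (G.parallel j).degree v = G.degree v + G.ends v j := by
  simp [degree_eq_sum_ends, Fin.sum_univ_castSucc, ends, parallel]

/-- The edges `(x, z)` and `(z, y)` together have the same ends at `v` as `(x, y)`, unless `v` is the
new node `z`. -/
lemma degree_serial (G : Network n) (j : Fin n) {v : Node} (hv : v ≠ Node.inner (n + 1)) :
    (G.serial j).degree v = G.degree v := by
  have h (i : Fin n) : (if Function.update G.head j (Node.inner (n + 1)) i = v then 1 else 0)
      + (if i = j then (if G.head j = v then 1 else 0) else 0) = if G.head i = v then 1 else 0 := by
    by_cases hij : i = j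
    · subst hij; simp [hv.symm]
    · simp [hij]
  have h2 : (∑ i, if Function.update G.head j (Node.inner (n + 1)) i = v then 1 else 0)
      + (if G.head j = v then 1 else 0) = ∑ i, if G.head i = v then 1 else 0 := by
    rw [← Finset.sum_congr rfl fun i _ => h i, Finset.sum_add_distrib]
    simp
  simp only [degree_eq_sum_ends, Fin.sum_univ_castSucc, ends, serial, Fin.snoc_castSucc,
    Fin.snoc_last, hv.symm, if_false, Finset.sum_add_distrib]
  omega

/-- No edge is a loop at `v`. -/
def LoopFreeAt (G : Network n) (v : Node) : Prop :=
  ∀ j, G.ends v j ≤ 1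

lemma LoopFreeAt.parallel {G : Network n} {v : Node} (h : G.LoopFreeAt v) (j : Fin n) :
    (G.parallel j).LoopFreeAt v := by
  intro i
  induction i using Fin.lastCases with
  | last => simpa [ends, Network.parallel] using h j
  | cast i => simpa [ends, Network.parallel] using h i

lemma LoopFreeAt.serial {G : Network n} {v : Node} (h : G.LoopFreeAt v)
    (hv : v ≠ Node.inner (n + 1)) (j : Fin n) : (G.serial j).LoopFreeAt v := by
  intro i
  induction i using Fin.lastCases with
  | last =>
    simp only [ends, Network.serial, Fin.snoc_last, hv.symm, if_false]
    split_ifs <;> simp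
  | cast i =>
    have := h i
    by_cases hij : i = j
    · subst hij
      simp only [ends, Network.serial, Fin.snoc_castSucc, Function.update_self, hv.symm,
        if_false]
      split_ifs <;> simp
    · simpa [ends, Network.serial, hij] using this

lemma LoopFreeAt.degree_le {G : Network n} {v : Node} (h : G.LoopFreeAt v) : G.degree v ≤ n := by
  rw [degree_eq_sum_ends]
  exact (Finset.sum_le_sum fun j _ => h j).trans (by simp)

end Network

/-! ### The law of the degree of a pole -/

section Model

variable {p : ℝ} {hp : p ∈ Set.Ioo (0 : ℝ) 1} {v : Node}

/-- The random growth step of the Bernoulli model, applied to a network with `n + 1` edges. -/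
noncomputable def growthStep (p : ℝ) (hp : p ∈ Set.Ioo (0 : ℝ) 1) {n : ℕ} (G : Network (n + 1)) :
    PMF (Network (n + 2)) :=
  (PMF.uniformOfFintype (Fin (n + 1))).bind fun j =>
    (coin p hp).map fun b => if b then G.parallel j else G.serial j

lemma bernoulliModel_add_two (n : ℕ) :
    bernoulliModel p hp (n + 2) = (bernoulliModel p hp (n + 1)).bind (growthStep p hp) := rfl

lemma bernoulliModel_one : bernoulliModel p hp 1 = PMF.pure Network.single := rfl

lemma not_inner_of_pole (hv : v = Node.source ∨ v = Node.sink) (k : ℕ) : v ≠ Node.inner k := by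
  rcases hv with rfl | rfl <;> simp

lemma degree_single (hv : v = Node.source ∨ v = Node.sink) : Network.single.degree v = 1 := by
  rcases hv with rfl | rfl <;> simp [Network.degree, Network.single]

lemma loopFreeAt_single (hv : v = Node.source ∨ v = Node.sink) :
    Network.single.LoopFreeAt v := by
  intro j
  rcases hv with rfl | rfl <;> simp [Network.ends, Network.single]

lemma mem_support_growthStep {n : ℕ} {G : Network (n + 1)} {H : Network (n + 2)}
    (h : H ∈ (growthStep p hp G).support) : ∃ j, H = G.parallel j ∨ H = G.serial j := by
  simp only [growthStep, PMF.mem_support_bind_iff, PMF.mem_support_map_iff] at h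
  obtain ⟨j, -, b, -, rfl⟩ := h
  refine ⟨j, ?_⟩
  cases b <;> simp

lemma loopFreeAt_and_one_le_degree_of_mem_support (hv : v = Node.source ∨ v = Node.sink)
    {n : ℕ} {G : Network (n + 1)} (hG : G ∈ (bernoulliModel p hp (n + 1)).support) :
    G.LoopFreeAt v ∧ 1 ≤ G.degree v := by
  induction n with
  | zero =>
    obtain rfl : G = Network.single := (PMF.mem_support_pure_iff _ _).1 hG
    exact ⟨loopFreeAt_single hv, (degree_single hv).ge⟩
  | succ n ih =>
    rw [bernoulliModel_add_two, PMF.mem_support_bind_iff] at hG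
    obtain ⟨H, hH, hG⟩ := hG
    obtain ⟨h1, h2⟩ := ih hH
    obtain ⟨j, rfl | rfl⟩ := mem_support_growthStep hG
    · exact ⟨h1.parallel j, by rw [Network.degree_parallel]; omega⟩
    · have h := not_inner_of_pole hv (n + 1 + 1)
      exact ⟨h1.serial h j, by rw [Network.degree_serial _ _ h]; exact h2⟩

lemma degree_mem_of_mem_support (hv : v = Node.source ∨ v = Node.sink) {n : ℕ} (hn : 1 ≤ n)
    {G : Network n} (hG : G ∈ (bernoulliModel p hp n).support) :
    1 ≤ G.degree v ∧ G.degree v ≤ n := by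
  obtain ⟨n, rfl⟩ := Nat.exists_eq_add_of_le' hn
  obtain ⟨h1, h2⟩ := loopFreeAt_and_one_le_degree_of_mem_support hv hG
  exact ⟨h2, h1.degree_le⟩

lemma coin_map_toMeasure {α : Type*} [MeasurableSpace α] (f : Bool → α) {s : Set α}
    [DecidablePred (· ∈ s)] (hs : MeasurableSet s) :
    ((coin p hp).map f).toMeasure s = ENNReal.ofReal
      (p * (if f true ∈ s then 1 else 0) + (1 - p) * (if f false ∈ s then 1 else 0)) := by
  rw [PMF.toMeasure_map_apply f _ s (measurable_of_finite f) hs,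
    PMF.toMeasure_apply_fintype, Fintype.sum_bool,
    ENNReal.ofReal_add (by have := hp.1; split_ifs <;> simp [this.le])
      (by have := hp.2; split_ifs <;> simp [this.le])]
  have ht : coin p hp true = ENNReal.ofReal p := by simp [coin]
  have hf : coin p hp false = ENNReal.ofReal (1 - p) := by simp [coin]
  by_cases h1 : f true ∈ s <;> by_cases h2 : f false ∈ s <;> simp [h1, h2, ht, hf]

/-- One growth step turns degree `k` into `k + 1` with probability `p k / n`, where `n` here
is the number of edges, and leaves it unchanged otherwise. -/
lemma growthStep_degree (hv : v = Node.source ∨ v = Node.sink) {n : ℕ} {G : Network (n + 1)}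
    (hG : G.LoopFreeAt v) (m : ℕ) :
    (growthStep p hp G).toMeasure {H | H.degree v = m} = ENNReal.ofReal
      ((1 - p * G.degree v / (n + 1)) * (if G.degree v = m then 1 else 0)
        + p * G.degree v / (n + 1) * (if G.degree v + 1 = m then 1 else 0)) := by
  have hp0 := hp.1.le
  have hp1 := sub_nonneg.2 hp.2.le
  have hterm (j : Fin (n + 1)) : PMF.uniformOfFintype (Fin (n + 1)) j *
      ((coin p hp).map fun b => if b then G.parallel j else G.serial j).toMeasure
        {H | H.degree v = m} = ENNReal.ofReal (((n : ℝ) + 1)⁻¹ *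
        ((if G.degree v = m then 1 else 0) + p * (G.ends v j : ℝ) *
          ((if G.degree v + 1 = m then 1 else 0) - (if G.degree v = m then 1 else 0)))) := by
    classical
    rw [coin_map_toMeasure _ (MeasurableSpace.measurableSet_top), PMF.uniformOfFintype_apply,
      ENNReal.ofReal_mul (by positivity), ENNReal.ofReal_inv_of_pos (by positivity)]
    congr 2
    · rw [Fintype.card_fin, ← Nat.cast_add_one, ENNReal.ofReal_natCast]
    · simp only [Set.mem_ofPred_eq, if_true, Bool.false_eq_true, if_false, Network.degree_parallel,
        Network.degree_serial _ _ (not_inner_of_pole hv _)]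
      have := hG j
      interval_cases h : G.ends v j <;> split_ifs <;> simp_all [sub_eq_add_neg]
  have hnonneg (j : Fin (n + 1)) : 0 ≤ ((n : ℝ) + 1)⁻¹ *
        ((if G.degree v = m then 1 else 0) + p * (G.ends v j : ℝ) *
          ((if G.degree v + 1 = m then 1 else 0) - (if G.degree v = m then 1 else 0))) := by
    refine mul_nonneg (by positivity) ?_
    have := hG j
    interval_cases h : G.ends v j <;> split_ifs <;> simp <;> linarith
  rw [growthStep, PMF.toMeasure_bind_apply _ _ _ MeasurableSpace.measurableSet_top, tsum_fintype,
    Finset.sum_congr rfl fun j _ => hterm j, ← ENNReal.ofReal_sum_of_nonneg fun j _ => hnonneg j]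
  congr 1
  rw [← Finset.mul_sum, Finset.sum_add_distrib, ← Finset.sum_mul, ← Finset.mul_sum,
    ← Nat.cast_sum, ← Network.degree_eq_sum_ends]
  simp only [Finset.sum_const, Finset.card_univ, Fintype.card_fin, nsmul_eq_mul, Nat.cast_add,
    Nat.cast_one]
  field_simp
  ring

/-- The probability that the node `v` has degree `m` in the random network with `n` edges. -/
noncomputable def degreeProb (p : ℝ) (hp : p ∈ Set.Ioo (0 : ℝ) 1) (v : Node) (n m : ℕ) : ℝ :=
  (bernoulliModel p hp n).toMeasure.real {G | G.degree v = m}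

lemma degreeProb_eq_zero (hv : v = Node.source ∨ v = Node.sink) {n m : ℕ} (hn : 1 ≤ n)
    (hm : m = 0 ∨ n < m) : degreeProb p hp v n m = 0 := by
  rw [degreeProb, measureReal_eq_zero_iff,
    PMF.toMeasure_apply_eq_zero_iff _ MeasurableSpace.measurableSet_top, Set.disjoint_left]
  intro G hG h
  have := degree_mem_of_mem_support hv hn hG
  simp only [Set.mem_ofPred_eq] at h
  omega

lemma degreeProb_one (hv : v = Node.source ∨ v = Node.sink) (m : ℕ) :
    degreeProb p hp v 1 m = if m = 1 then 1 else 0 := by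
  rw [degreeProb, bernoulliModel_one, measureReal_def,
    PMF.toMeasure_pure_apply _ _ MeasurableSpace.measurableSet_top]
  simp only [Set.mem_ofPred_eq, degree_single hv, eq_comm (a := 1)]
  split_ifs <;> simp

/-- The forward equation of the Markov chain of degrees. -/
lemma degreeProb_succ (hv : v = Node.source ∨ v = Node.sink) {n : ℕ} (hn : 1 ≤ n) (m : ℕ) :
    degreeProb p hp v (n + 1) (m + 1) =
      (1 - p * (m + 1) / n) * degreeProb p hp v n (m + 1)
        + p * m / n * degreeProb p hp v n m := by
  have hp0 := hp.1.le
  obtain ⟨n, rfl⟩ := Nat.exists_eq_add_of_le' hn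
  set μ := bernoulliModel p hp (n + 1) with hμ
  have key : (bernoulliModel p hp (n + 2)).toMeasure {G | G.degree v = m + 1} =
      ENNReal.ofReal (1 - p * (m + 1) / (n + 1)) * μ.toMeasure {G | G.degree v = m + 1}
        + ENNReal.ofReal (p * m / (n + 1)) * μ.toMeasure {G | G.degree v = m} := by
    rw [bernoulliModel_add_two, PMF.toMeasure_bind_apply _ _ _ MeasurableSpace.measurableSet_top,
      PMF.toMeasure_apply _ MeasurableSpace.measurableSet_top,
      PMF.toMeasure_apply _ MeasurableSpace.measurableSet_top, ← ENNReal.tsum_mul_left,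
      ← ENNReal.tsum_mul_left, ← ENNReal.tsum_add]
    refine tsum_congr fun G => ?_
    by_cases hG : G ∈ μ.support
    · rw [growthStep_degree hv (loopFreeAt_and_one_le_degree_of_mem_support hv hG).1, ← hμ]
      simp only [Set.indicator_apply, Set.mem_ofPred_eq, Nat.add_right_cancel_iff]
      by_cases h1 : G.degree v = m + 1
      · simp [h1, mul_comm]
      · by_cases h2 : G.degree v = m
        · simp [h2, mul_comm]
        · simp [h1, h2]
    · rw [PMF.mem_support_iff, not_not] at hG
      simp [← hμ, hG, Set.indicator_apply]
  have hr := congrArg ENNReal.toReal key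
  rw [ENNReal.toReal_add (ENNReal.mul_ne_top ENNReal.ofReal_ne_top (measure_ne_top _ _))
    (ENNReal.mul_ne_top ENNReal.ofReal_ne_top (measure_ne_top _ _)), ENNReal.toReal_mul,
    ENNReal.toReal_mul,
    ENNReal.toReal_ofReal (r := p * m / (n + 1)) (by positivity)] at hr
  simp only [degreeProb, measureReal_def]
  rw [hr]
  push_cast
  congr 1
  -- The coefficient is nonnegative unless the probability next to it vanishes.
  rcases le_or_gt (m + 1) (n + 1) with h | h
  · rw [ENNReal.toReal_ofReal]
    have h' : (m : ℝ) + 1 ≤ n + 1 := by exact_mod_cast h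
    rw [sub_nonneg, div_le_one (by positivity)]
    nlinarith [hp.2, hp.1]
  · have := degreeProb_eq_zero (p := p) (hp := hp) hv hn (Or.inr h)
    rw [degreeProb, measureReal_def] at this
    rw [this, mul_zero, mul_zero]

lemma degreeProb_succ_zero (hv : v = Node.source ∨ v = Node.sink) (n : ℕ) :
    degreeProb p hp v (n + 1) 0 = 0 :=
  degreeProb_eq_zero hv (by simp) (Or.inl rfl)

lemma succ_mul_ringChoose_succ (x : ℝ) (k : ℕ) :
    ((k : ℝ) + 1) * Ring.choose x (k + 1) = Ring.choose x k * (x - k) := by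
  have h := Ring.choose_smul_choose x (Nat.le_succ k)
  simpa using h

/-- The explicit formula for the probabilities satisfies the forward equation, by the absorption
identity `(m - j) * m.choose j = m * (m - 1).choose j`. -/
lemma degreeProb_eq_sum (hv : v = Node.source ∨ v = Node.sink) (n m : ℕ) :
    degreeProb p hp v (n + 1) (m + 1) = ∑ j ∈ Finset.range (m + 1),
      (m.choose j : ℝ) * (-1 : ℝ) ^ (n + j) * Ring.choose (p * ((j : ℝ) + 1) - 1) n := by
  induction n generalizing m with
  | zero =>
    rw [zero_add, degreeProb_one hv]
    have h := Int.alternating_sum_range_choose (n := m)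
    have h' : ∑ j ∈ Finset.range (m + 1), (-1 : ℝ) ^ j * (m.choose j : ℝ) =
      if m = 0 then 1 else 0 := by exact_mod_cast congrArg (Int.cast : ℤ → ℝ) h
    simp only [zero_add, Ring.choose_zero_right, mul_one, Nat.add_eq_right]
    rw [← h']
    exact Finset.sum_congr rfl fun j _ => mul_comm _ _
  | succ n ih =>
    rw [degreeProb_succ hv (by simp), ih]
    have hN : (n : ℝ) + 1 ≠ 0 := by positivity
    have hchoose (j : ℕ) : Ring.choose (p * ((j : ℝ) + 1) - 1) (n + 1) =
        Ring.choose (p * ((j : ℝ) + 1) - 1) n * (p * (j + 1) - (n + 1)) / (n + 1) := by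
      rw [eq_div_iff hN, mul_comm, succ_mul_ringChoose_succ]; ring
    obtain _ | m := m
    · simp [hchoose, pow_succ]
      field_simp
      ring
    · rw [ih]
      -- Both sums may run over the same range, because `m.choose (m + 1) = 0`.
      have hext : ∑ j ∈ Finset.range (m + 1), (m.choose j : ℝ) * (-1 : ℝ) ^ (n + j) *
            Ring.choose (p * ((j : ℝ) + 1) - 1) n = ∑ j ∈ Finset.range (m + 2),
            (m.choose j : ℝ) * (-1 : ℝ) ^ (n + j) * Ring.choose (p * ((j : ℝ) + 1) - 1) n := by
        rw [Finset.sum_range_succ _ (m + 1)]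
        simp
      rw [hext, Finset.mul_sum, Finset.mul_sum, ← Finset.sum_add_distrib]
      refine Finset.sum_congr rfl fun j hj => ?_
      have hj : j ≤ m + 1 := by simpa [Nat.lt_succ_iff] using hj
      have habs : ((m + 1).choose j : ℝ) * ((m : ℝ) + 1 - j) = (m + 1) * (m.choose j : ℝ) := by
        have := Nat.choose_mul_succ_eq m j
        rw [← Nat.cast_add_one, ← Nat.cast_sub hj, ← Nat.cast_mul, ← Nat.cast_mul]
        exact_mod_cast (by rw [← this, mul_comm])
      rw [hchoose, show n + 1 + j = n + j + 1 by ring, pow_succ]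
      push_cast
      field_simp
      linear_combination (-Ring.choose (p * ((j : ℝ) + 1) - 1) n * p) * habs

end Model

/-! ### Moments of the degree -/

section Moments

variable {p : ℝ} {hp : p ∈ Set.Ioo (0 : ℝ) 1} {v : Node}

lemma ae_degree_mem (hv : v = Node.source ∨ v = Node.sink) {n : ℕ} (hn : 1 ≤ n) :
    ∀ᵐ G ∂(bernoulliModel p hp n).toMeasure, 1 ≤ G.degree v ∧ G.degree v ≤ n := by
  rw [ae_iff, PMF.toMeasure_apply_eq_zero_iff _ MeasurableSpace.measurableSet_top,
    Set.disjoint_left]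
  exact fun G hG h => h (degree_mem_of_mem_support hv hn hG)

lemma ae_eq_sum_indicator (hv : v = Node.source ∨ v = Node.sink) {n : ℕ} (hn : 1 ≤ n)
    (f : ℕ → ℝ) : (fun G => f (G.degree v)) =ᵐ[(bernoulliModel p hp n).toMeasure]
      fun G => ∑ m ∈ Finset.range (n + 1),
        Set.indicator {G : Network n | G.degree v = m} (fun _ => f m) G := by
  filter_upwards [ae_degree_mem (p := p) (hp := hp) hv hn] with G hG
  rw [Finset.sum_eq_single (G.degree v)]
  · simp
  · intro m _ hm
    simp [hm.symm]
  · intro h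
    simp at h
    omega

lemma integrable_comp_degree (hv : v = Node.source ∨ v = Node.sink) {n : ℕ} (hn : 1 ≤ n)
    (f : ℕ → ℝ) : Integrable (fun G => f (G.degree v)) (bernoulliModel p hp n).toMeasure := by
  rw [integrable_congr (ae_eq_sum_indicator hv hn f)]
  exact integrable_finsetSum _ fun m _ =>
    (integrable_const _).indicator MeasurableSpace.measurableSet_top

lemma integral_comp_degree (hv : v = Node.source ∨ v = Node.sink) {n : ℕ} (hn : 1 ≤ n)
    (f : ℕ → ℝ) : ∫ G, f (G.degree v) ∂(bernoulliModel p hp n).toMeasure =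
      ∑ m ∈ Finset.range (n + 1), degreeProb p hp v n m * f m := by
  rw [integral_congr_ae (ae_eq_sum_indicator hv hn f), integral_finsetSum _ fun m _ =>
    (integrable_const _).indicator MeasurableSpace.measurableSet_top]
  refine Finset.sum_congr rfl fun m _ => ?_
  rw [integral_indicator_const _ MeasurableSpace.measurableSet_top, smul_eq_mul, degreeProb]

/-- The rising factorial moments of the degree satisfy a one-term recursion, because
`k (k + 1)^(r) = (k + r) k^(r)` for the rising factorial `k^(r)`. -/
lemma integral_ascPochhammer_degree (hv : v = Node.source ∨ v = Node.sink) (n r : ℕ) :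
    ∫ G, (ascPochhammer ℝ r).eval (G.degree v : ℝ) ∂(bernoulliModel p hp (n + 1)).toMeasure =
      r ! * ∏ i ∈ Finset.range n, (1 + p * r / (i + 1)) := by
  rw [integral_comp_degree hv (by simp) fun k => (ascPochhammer ℝ r).eval (k : ℝ)]
  induction n with
  | zero => simp [degreeProb_one hv, ascPochhammer_eval_one]
  | succ n ih =>
    rw [Finset.prod_range_succ, ← mul_assoc, ← ih, Finset.sum_range_succ',
      degreeProb_succ_zero hv, zero_mul, add_zero]
    set f : ℕ → ℝ := fun k => (ascPochhammer ℝ r).eval (k : ℝ) with hf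
    have hrec (k : ℕ) : (k : ℝ) * f (k + 1) = f k * (k + r) := by
      have h1 := ascPochhammer_succ_eval (S := ℝ) r k
      rw [ascPochhammer_succ_left] at h1
      simpa [hf] using h1
    have h1 : ∑ k ∈ Finset.range (n + 1 + 1), degreeProb p hp v (n + 1 + 1) (k + 1) * f (k + 1) =
        ∑ k ∈ Finset.range (n + 1 + 1),
          (1 - p * ((k + 1 : ℕ) : ℝ) / (n + 1)) * degreeProb p hp v (n + 1) (k + 1) * f (k + 1)
        + ∑ k ∈ Finset.range (n + 1 + 1),
          p * k / (n + 1) * degreeProb p hp v (n + 1) k * f (k + 1) := by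
      rw [← Finset.sum_add_distrib]
      refine Finset.sum_congr rfl fun k _ => ?_
      rw [degreeProb_succ hv (by simp)]
      push_cast
      ring
    have h2 : ∑ k ∈ Finset.range (n + 1 + 1),
          (1 - p * ((k + 1 : ℕ) : ℝ) / (n + 1)) * degreeProb p hp v (n + 1) (k + 1) * f (k + 1) =
        ∑ k ∈ Finset.range (n + 1 + 1),
          (1 - p * (k : ℝ) / (n + 1)) * degreeProb p hp v (n + 1) k * f k := by
      have h := Finset.sum_range_succ' (fun k : ℕ =>
        (1 - p * (k : ℝ) / (n + 1)) * degreeProb p hp v (n + 1) k * f k) (n + 1 + 1)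
      rw [degreeProb_succ_zero hv, mul_zero, zero_mul, add_zero] at h
      rw [← h, Finset.sum_range_succ, degreeProb_eq_zero hv (by simp) (Or.inr (by simp)),
        mul_zero, zero_mul, add_zero]
    change ∑ k ∈ Finset.range (n + 1 + 1), degreeProb p hp v (n + 1 + 1) (k + 1) * f (k + 1) = _
    rw [h1, h2, ← Finset.sum_add_distrib, Finset.sum_mul]
    refine Finset.sum_congr rfl fun k _ => ?_
    have hk := hrec k
    have hN : (n : ℝ) + 1 ≠ 0 := by positivity
    field_simp
    linear_combination (degreeProb p hp v (n + 1) k * p) * hk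

/-- Euler's limit formula for the Gamma function. -/
lemma tendsto_prod_one_add_div_rpow {s : ℝ} (hs : 0 ≤ s) :
    Tendsto (fun n : ℕ => (∏ i ∈ Finset.range n, (1 + s / (i + 1))) / ((n + 1 : ℕ) : ℝ) ^ s) atTop
      (𝓝 (Real.Gamma (s + 1))⁻¹) := by
  have hΓ : Real.Gamma (s + 1) ≠ 0 := (Real.Gamma_pos_of_pos (by positivity)).ne'
  have h1 := ((Real.GammaSeq_tendsto_Gamma (s + 1)).inv₀ hΓ)
  have h2 : Tendsto (fun n : ℕ => (n : ℝ) / (n + (s + 1))) atTop (𝓝 1) :=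
    tendsto_natCast_div_add_atTop _
  have h3 : Tendsto (fun n : ℕ => ((n : ℝ) / (n + 1)) ^ s) atTop (𝓝 (1 ^ s)) :=
    (tendsto_natCast_div_add_atTop (1 : ℝ)).rpow_const (Or.inl one_ne_zero)
  have h4 := (h1.mul h2).mul h3
  rw [Real.one_rpow, mul_one, mul_one] at h4
  refine h4.congr' ?_
  filter_upwards [eventually_ge_atTop 1] with n hn
  have hn0 : (0 : ℝ) < n := by exact_mod_cast hn
  have hprod : ∏ i ∈ Finset.range n, (1 + s / ((i : ℝ) + 1)) =
      (∏ i ∈ Finset.range n, (s + 1 + i)) / n ! := by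
    rw [← Finset.prod_range_add_one_eq_factorial, Nat.cast_prod, ← Finset.prod_div_distrib]
    refine Finset.prod_congr rfl fun i _ => ?_
    push_cast
    field_simp
    ring
  have hP : (∏ i ∈ Finset.range n, (s + 1 + (i : ℝ))) ≠ 0 :=
    Finset.prod_ne_zero_iff.2 fun i _ => by positivity
  rw [hprod, Real.GammaSeq, Finset.prod_range_succ, Real.rpow_add hn0, Real.rpow_one,
    Real.div_rpow hn0.le (by positivity)]
  have : (n : ℝ) ^ s ≠ 0 := (Real.rpow_pos_of_pos hn0 _).ne'
  have : ((n : ℝ) + 1) ^ s ≠ 0 := (Real.rpow_pos_of_pos (by positivity) _).ne'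
  have : s + 1 + (n : ℝ) ≠ 0 := by positivity
  push_cast
  field_simp
  ring

lemma tendsto_integral_ascPochhammer_degree (hv : v = Node.source ∨ v = Node.sink) (r : ℕ) :
    Tendsto (fun n : ℕ => (∫ G, (ascPochhammer ℝ r).eval (G.degree v : ℝ)
      ∂(bernoulliModel p hp n).toMeasure) / (n : ℝ) ^ (r * p)) atTop
      (𝓝 ((r ! : ℝ) / Real.Gamma ((r : ℝ) * p + 1))) := by
  rw [← tendsto_add_atTop_iff_nat 1]
  have h := (tendsto_prod_one_add_div_rpow (s := r * p)
    (mul_nonneg r.cast_nonneg hp.1.le)).const_mul (r ! : ℝ)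
  rw [← div_eq_mul_inv] at h
  refine h.congr fun n => ?_
  rw [integral_ascPochhammer_degree hv, mul_comm p, mul_div_assoc]

/-- Passing from rising factorials to powers does not change the limit: the difference has lower
degree, and the lower moments are of smaller order. -/
lemma tendsto_integral_degree_pow (hv : v = Node.source ∨ v = Node.sink) (r : ℕ) :
    Tendsto (fun n : ℕ => (∫ G, (G.degree v : ℝ) ^ r
      ∂(bernoulliModel p hp n).toMeasure) / (n : ℝ) ^ (r * p)) atTop
      (𝓝 ((r ! : ℝ) / Real.Gamma ((r : ℝ) * p + 1))) := by
  induction r using Nat.strong_induction_on with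
  | _ r ih =>
  set q : Polynomial ℝ := Polynomial.X ^ r - ascPochhammer ℝ r with hq
  have hlow (k : ℕ) (hk : k < r) : Tendsto (fun n : ℕ => (∫ G, (G.degree v : ℝ) ^ k
      ∂(bernoulliModel p hp n).toMeasure) / (n : ℝ) ^ (r * p)) atTop (𝓝 0) := by
    have hpos : 0 < ((r : ℝ) - k) * p := mul_pos (sub_pos.2 (by exact_mod_cast hk)) hp.1
    have h0 := (tendsto_rpow_neg_atTop hpos).comp tendsto_natCast_atTop_atTop
    have h := (ih k hk).mul h0
    rw [mul_zero] at h
    refine h.congr' ?_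
    filter_upwards [eventually_ge_atTop 1] with n hn
    have hn0 : (0 : ℝ) < n := by exact_mod_cast hn
    rw [Function.comp_apply, Real.rpow_neg hn0.le, ← div_eq_mul_inv, div_div,
      ← Real.rpow_add hn0]
    ring_nf
  have hdeg : q.degree < r := by
    rcases Nat.eq_zero_or_pos r with rfl | hr
    · simp [hq]
    · have h1 : (Polynomial.X ^ r : Polynomial ℝ).degree = r := Polynomial.degree_X_pow r
      have h2 : (ascPochhammer ℝ r).degree = r := by
        rw [Polynomial.degree_eq_natDegree (monic_ascPochhammer ℝ r).ne_zero,
          ascPochhammer_natDegree]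
      have := Polynomial.degree_sub_lt_left (h1.trans h2.symm) (Polynomial.monic_X_pow r).ne_zero
        (by rw [(Polynomial.monic_X_pow r).leadingCoeff, (monic_ascPochhammer ℝ r).leadingCoeff])
      rwa [h1] at this
  have hqlim : Tendsto (fun n : ℕ => (∫ G, q.eval (G.degree v : ℝ)
      ∂(bernoulliModel p hp n).toMeasure) / (n : ℝ) ^ (r * p)) atTop (𝓝 0) := by
    have h := tendsto_finsetSum (Finset.range r) fun k hk =>
      (hlow k (Finset.mem_range.1 hk)).const_mul (q.coeff k)
    simp only [mul_zero, Finset.sum_const_zero] at h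
    refine h.congr' ?_
    filter_upwards [eventually_ge_atTop 1] with n hn
    have heval (x : ℝ) : q.eval x = ∑ k ∈ Finset.range r, q.coeff k * x ^ k := by
      rcases eq_or_ne q 0 with h0 | h0
      · simp [h0]
      · exact Polynomial.eval_eq_sum_range' ((Polynomial.natDegree_lt_iff_degree_lt h0).2 hdeg) x
    simp only [heval]
    rw [integral_finsetSum _ fun k _ => (integrable_comp_degree hv hn
      fun d => (d : ℝ) ^ k).const_mul _, Finset.sum_div]
    refine Finset.sum_congr rfl fun k _ => ?_
    rw [integral_const_mul, mul_div_assoc]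
  have h := hqlim.add (tendsto_integral_ascPochhammer_degree (p := p) (hp := hp) hv r)
  rw [zero_add] at h
  refine h.congr' ?_
  filter_upwards [eventually_ge_atTop 1] with n hn
  rw [← add_div, ← integral_add (integrable_comp_degree hv hn fun d => q.eval (d : ℝ))
    (integrable_comp_degree hv hn fun d => (ascPochhammer ℝ r).eval (d : ℝ))]
  simp [hq]

/-- The random variable `D_n / n^p`, where `D_n` is the degree of `v`. -/
noncomputable def scaledDegree (p : ℝ) (v : Node) (n : ℕ) (G : Network n) : ℝ :=
  (G.degree v : ℝ) / (n : ℝ) ^ p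

lemma measurable_scaledDegree (n : ℕ) : Measurable (scaledDegree p v n) :=
  measurable_from_top

lemma integrable_scaledDegree_pow (hv : v = Node.source ∨ v = Node.sink) {n : ℕ} (hn : 1 ≤ n)
    (r : ℕ) :
    Integrable (fun G => scaledDegree p v n G ^ r) (bernoulliModel p hp n).toMeasure :=
  integrable_comp_degree hv hn fun d => ((d : ℝ) / (n : ℝ) ^ p) ^ r

lemma tendsto_integral_scaledDegree_pow (hv : v = Node.source ∨ v = Node.sink) (r : ℕ) :
    Tendsto (fun n : ℕ => ∫ G, scaledDegree p v n G ^ r ∂(bernoulliModel p hp n).toMeasure) atTop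
      (𝓝 ((r ! : ℝ) / Real.Gamma ((r : ℝ) * p + 1))) := by
  refine (tendsto_integral_degree_pow (p := p) (hp := hp) hv r).congr fun n => ?_
  simp only [scaledDegree, div_pow]
  rw [integral_div, mul_comm (r : ℝ), Real.rpow_mul n.cast_nonneg, Real.rpow_natCast]

end Moments

/-! ### The method of moments -/

section MethodOfMoments

/-- All moments of `μ` exist, and the `r`-th one is `m r`. -/
def HasMoments (μ : ProbabilityMeasure ℝ) (m : ℕ → ℝ) : Prop :=
  ∀ r : ℕ, Integrable (fun x : ℝ => x ^ r) (μ : Measure ℝ) ∧ ∫ x, x ^ r ∂(μ : Measure ℝ) = m r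

variable {ν : ℕ → ProbabilityMeasure ℝ} {μ : ProbabilityMeasure ℝ} {m : ℕ → ℝ}

/-- Lower semicontinuity of the integral of a nonnegative continuous function under weak
convergence. -/
lemma integrable_and_integral_le_of_tendsto (hν : Tendsto ν atTop (𝓝 μ)) {f : ℝ → ℝ}
    (hf : Continuous f) (hf0 : 0 ≤ f) (hint : ∀ n, Integrable f (ν n : Measure ℝ)) {c : ℝ}
    (hlim : Tendsto (fun n => ∫ x, f x ∂(ν n : Measure ℝ)) atTop (𝓝 c)) :
    Integrable f (μ : Measure ℝ) ∧ ∫ x, f x ∂(μ : Measure ℝ) ≤ c := by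
  have h := lintegral_le_liminf_lintegral_of_forall_isOpen_measure_le_liminf_measure
    (μ := (μ : Measure ℝ)) (μs := fun n => (ν n : Measure ℝ)) hf hf0
    fun G hG => ProbabilityMeasure.le_liminf_measure_open_of_tendsto hν hG
  have heq (n : ℕ) : ∫⁻ x, ENNReal.ofReal (f x) ∂(ν n : Measure ℝ) =
      ENNReal.ofReal (∫ x, f x ∂(ν n : Measure ℝ)) :=
    (ofReal_integral_eq_lintegral_ofReal (hint n) (ae_of_all _ hf0)).symm
  simp only [heq] at h
  rw [(ENNReal.tendsto_ofReal hlim).liminf_eq] at h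
  have hi : Integrable f (μ : Measure ℝ) := by
    refine ⟨hf.aestronglyMeasurable, ?_⟩
    rw [hasFiniteIntegral_iff_ofReal (ae_of_all _ hf0)]
    exact h.trans_lt ENNReal.ofReal_lt_top
  refine ⟨hi, ?_⟩
  rw [← ofReal_integral_eq_lintegral_ofReal hi (ae_of_all _ hf0)] at h
  exact (ENNReal.ofReal_le_ofReal_iff
    (ge_of_tendsto' hlim fun n => integral_nonneg hf0)).1 h

/-- A weak limit of measures with convergent moments has the limits of the moments as its moments.
By lower semicontinuity, `∫ (x ^ r + b) ^ 2` does not exceed the limit of these integrals. As this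
holds for every `b`, the terms that are linear in `b` agree. -/
lemma hasMoments_of_tendsto (hν : Tendsto ν atTop (𝓝 μ))
    (hint : ∀ n (r : ℕ), Integrable (fun x : ℝ => x ^ r) (ν n : Measure ℝ))
    (hlim : ∀ r : ℕ, Tendsto (fun n => ∫ x, x ^ r ∂(ν n : Measure ℝ)) atTop (𝓝 (m r))) :
    HasMoments μ m := by
  have hexp (κ : ProbabilityMeasure ℝ)
      (hκ : ∀ r : ℕ, Integrable (fun x : ℝ => x ^ r) (κ : Measure ℝ)) (r : ℕ) (b : ℝ) :
      Integrable (fun x : ℝ => (x ^ r + b) ^ 2) (κ : Measure ℝ) ∧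
      ∫ x, (x ^ r + b) ^ 2 ∂(κ : Measure ℝ) =
        ∫ x, x ^ (2 * r) ∂(κ : Measure ℝ) + 2 * b * ∫ x, x ^ r ∂(κ : Measure ℝ) + b ^ 2 := by
    have hpt : (fun x : ℝ => (x ^ r + b) ^ 2) = fun x => x ^ (2 * r) + 2 * b * x ^ r + b ^ 2 := by
      funext x
      ring
    have h1 : Integrable (fun x : ℝ => x ^ (2 * r) + 2 * b * x ^ r) (κ : Measure ℝ) :=
      (hκ (2 * r)).add ((hκ r).const_mul (2 * b))
    rw [hpt]
    refine ⟨h1.add (integrable_const _), ?_⟩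
    rw [integral_add h1 (integrable_const _), integral_add (hκ _) ((hκ r).const_mul _),
      integral_const_mul]
    simp
  have heven (r : ℕ) : Integrable (fun x : ℝ => x ^ (2 * r)) (μ : Measure ℝ) :=
    (integrable_and_integral_le_of_tendsto hν (by fun_prop)
      (fun x => by rw [pow_mul]; positivity) (fun n => hint n _) (hlim _)).1
  have hμ (r : ℕ) : Integrable (fun x : ℝ => x ^ r) (μ : Measure ℝ) := by
    refine ((heven r).add (integrable_const 1)).mono' (by fun_prop) (ae_of_all _ fun x => ?_)
    rw [Real.norm_eq_abs, Pi.add_apply, mul_comm, pow_mul, ← sq_abs (x ^ r)]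
    nlinarith [sq_nonneg (|x ^ r| - 1), sq_nonneg (|x ^ r|)]
  refine fun r => ⟨hμ r, ?_⟩
  have hineq (b : ℝ) : ∫ x, x ^ (2 * r) ∂(μ : Measure ℝ) +
      2 * b * ∫ x, x ^ r ∂(μ : Measure ℝ) + b ^ 2 ≤ m (2 * r) + 2 * b * m r + b ^ 2 := by
    rw [← (hexp μ hμ r b).2]
    refine (integrable_and_integral_le_of_tendsto hν (f := fun x : ℝ => (x ^ r + b) ^ 2)
      (by fun_prop) (fun x => sq_nonneg _)
      (fun n => (hexp (ν n) (hint n) r b).1) ?_).2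
    simp only [fun n => (hexp (ν n) (hint n) r b).2]
    exact ((hlim _).add ((hlim r).const_mul _)).add_const _
  -- If the slopes differed, `b := (e + 1) / (2 d)` would violate `2 b d ≤ e`.
  by_contra hne
  set d := ∫ x, x ^ r ∂(μ : Measure ℝ) - m r with hd
  have hd0 : d ≠ 0 := sub_ne_zero.2 hne
  set e := m (2 * r) - ∫ x, x ^ (2 * r) ∂(μ : Measure ℝ) with he
  have hlin (b : ℝ) : 2 * b * d ≤ e := by have := hineq b; linarith
  have := hlin ((e + 1) / (2 * d))
  rw [show 2 * ((e + 1) / (2 * d)) * d = e + 1 by field_simp] at this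
  linarith

/-- Bounded second moments imply tightness, by Markov's inequality. -/
lemma isCompact_closure_range_of_integral_sq_le {C : ℝ}
    (hint : ∀ n, Integrable (fun x : ℝ => x ^ 2) (ν n : Measure ℝ))
    (hC : ∀ n, ∫ x, x ^ 2 ∂(ν n : Measure ℝ) ≤ C) : IsCompact (closure (Set.range ν)) := by
  refine isCompact_closure_of_isTightMeasureSet ?_
  rw [isTightMeasureSet_iff_exists_isCompact_measure_compl_le]
  intro ε hε
  have hC0 : 0 ≤ C := (integral_nonneg fun x => sq_nonneg x).trans (hC 0)
  obtain ⟨δ, hδ0, hδ⟩ : ∃ δ : ℝ, 0 < δ ∧ ENNReal.ofReal δ ≤ ε := by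
    rcases eq_or_ne ε ⊤ with rfl | h
    · exact ⟨1, one_pos, le_top⟩
    · exact ⟨ε.toReal, ENNReal.toReal_pos hε.ne' h, ENNReal.ofReal_toReal_le⟩
  refine ⟨Metric.closedBall 0 (√((C + 1) / δ)), isCompact_closedBall _ _, ?_⟩
  rintro _ ⟨_, ⟨n, rfl⟩, rfl⟩
  refine le_trans ?_ hδ
  have hsub : (Metric.closedBall (0 : ℝ) (√((C + 1) / δ)))ᶜ ⊆ {x : ℝ | (C + 1) / δ ≤ x ^ 2} := by
    intro x hx
    simp only [Set.mem_compl_iff, Metric.mem_closedBall, dist_zero_right, Real.norm_eq_abs,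
      not_le] at hx
    rw [Set.mem_ofPred_eq, ← sq_abs]
    exact (Real.sqrt_le_left (abs_nonneg x)).1 hx.le
  have hmarkov := mul_meas_ge_le_integral_of_nonneg (ae_of_all _ fun x : ℝ => sq_nonneg x)
    (hint n) ((C + 1) / δ)
  refine (measure_mono hsub).trans ?_
  rw [ENNReal.le_ofReal_iff_toReal_le (measure_ne_top _ _) hδ0.le, ← measureReal_def]
  have h := hmarkov.trans (hC n)
  have h1 : 0 < (C + 1) / δ := by positivity
  rw [← mul_le_mul_iff_right₀ h1]
  calc _ ≤ C := h
    _ ≤ C + 1 := by linarith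
    _ = (C + 1) / δ * δ := by field_simp

lemma isCompact_closure_range_of_tendsto_moments
    (hint : ∀ n (r : ℕ), Integrable (fun x : ℝ => x ^ r) (ν n : Measure ℝ))
    (hlim : ∀ r : ℕ, Tendsto (fun n => ∫ x, x ^ r ∂(ν n : Measure ℝ)) atTop (𝓝 (m r))) :
    IsCompact (closure (Set.range ν)) := by
  obtain ⟨C, hC⟩ := (hlim 2).bddAbove_range
  exact isCompact_closure_range_of_integral_sq_le (fun n => hint n 2)
    fun n => hC (Set.mem_range_self n)

/-- Limits of moments are moments: by Prokhorov's theorem, a subsequence converges weakly. -/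
lemma exists_hasMoments_of_tendsto_moments
    (hint : ∀ n (r : ℕ), Integrable (fun x : ℝ => x ^ r) (ν n : Measure ℝ))
    (hlim : ∀ r : ℕ, Tendsto (fun n => ∫ x, x ^ r ∂(ν n : Measure ℝ)) atTop (𝓝 (m r))) :
    ∃ μ, HasMoments μ m := by
  obtain ⟨μ, -, u, hu, hμ⟩ := (isCompact_closure_range_of_tendsto_moments hint hlim).tendsto_subseq
    fun n => subset_closure (Set.mem_range_self n)
  exact ⟨μ, hasMoments_of_tendsto hμ (fun n => hint (u n))
    fun r => (hlim r).comp hu.tendsto_atTop⟩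

/-- The method of moments: convergence of all moments to those of a measure that is determined by
its moments implies weak convergence. -/
lemma tendsto_of_tendsto_moments
    (hint : ∀ n (r : ℕ), Integrable (fun x : ℝ => x ^ r) (ν n : Measure ℝ))
    (hlim : ∀ r : ℕ, Tendsto (fun n => ∫ x, x ^ r ∂(ν n : Measure ℝ)) atTop (𝓝 (m r)))
    (hμ : ∀ κ, HasMoments κ m → κ = μ) : Tendsto ν atTop (𝓝 μ) := by
  refine (isCompact_closure_range_of_tendsto_moments hint hlim).tendsto_nhds_of_unique_mapClusterPt
    (Eventually.of_forall fun n => subset_closure (Set.mem_range_self n)) fun κ _ hκ => hμ κ ?_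
  obtain ⟨u, hu, hκ⟩ := hκ.tendsto_subseq
  exact hasMoments_of_tendsto hκ (fun n => hint (u n)) fun r => (hlim r).comp hu.tendsto_atTop

end MethodOfMoments

/-! ### Determinacy of the moment problem -/

section Determinacy

variable {m : ℕ → ℝ}

/-- The expansion of `cosh` only involves even powers, so that absolute moments of odd order do not
enter. -/
lemma integrable_cosh_of_hasMoments {μ : ProbabilityMeasure ℝ} (hμ : HasMoments μ m) {t : ℝ}
    (ht : Summable fun k : ℕ => m k / k ! * t ^ k) :
    Integrable (fun x => Real.cosh (t * x)) (μ : Measure ℝ) := by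
  have hterm (k : ℕ) (x : ℝ) : 0 ≤ (t * x) ^ (2 * k) / (2 * k)! := by
    rw [pow_mul]; positivity
  have hint (k : ℕ) :
      Integrable (fun x : ℝ => (t * x) ^ (2 * k) / (2 * k)!) (μ : Measure ℝ) := by
    simp only [mul_pow]
    exact ((hμ (2 * k)).1.const_mul _).div_const _
  have hval (k : ℕ) : ∫ x : ℝ, (t * x) ^ (2 * k) / (2 * k)! ∂(μ : Measure ℝ) =
      m (2 * k) / (2 * k)! * t ^ (2 * k) := by
    simp only [mul_pow]
    rw [integral_div, integral_const_mul, (hμ (2 * k)).2]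
    ring
  have hsum : Summable fun k : ℕ => m (2 * k) / (2 * k)! * t ^ (2 * k) :=
    ht.comp_injective (mul_right_injective₀ two_ne_zero)
  refine ⟨by fun_prop, ?_⟩
  rw [hasFiniteIntegral_iff_ofReal (ae_of_all _ fun x => (Real.cosh_pos _).le)]
  have hcosh (x : ℝ) : ENNReal.ofReal (Real.cosh (t * x)) =
      ∑' k : ℕ, ENNReal.ofReal ((t * x) ^ (2 * k) / (2 * k)!) := by
    have h := Real.hasSum_cosh (t * x)
    rw [← h.tsum_eq, ENNReal.ofReal_tsum_of_nonneg (fun k => hterm k x) h.summable]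
  simp only [hcosh]
  rw [lintegral_tsum fun k => by fun_prop]
  simp only [fun k => (ofReal_integral_eq_lintegral_ofReal (hint k)
    (ae_of_all _ (hterm k))).symm, hval]
  exact hsum.tsum_ofReal_lt_top

/-- If `∑ m k t ^ k / k!` converges for every `t`, then it represents the moment generating
function, also at complex arguments. -/
lemma hasSum_complexMGF_of_hasMoments {μ : ProbabilityMeasure ℝ} (hμ : HasMoments μ m)
    (hm : ∀ t : ℝ, Summable fun k : ℕ => m k / k ! * t ^ k) (z : ℂ) :
    HasSum (fun k : ℕ => z ^ k / k ! * (m k : ℂ))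
      (ProbabilityTheory.complexMGF id (μ : Measure ℝ) z) := by
  have hbound (x : ℝ) : HasSum (fun k : ℕ => (‖z‖ * |x|) ^ k / k !) (Real.exp (‖z‖ * |x|)) := by
    rw [Real.exp_eq_exp_ℝ]
    exact NormedSpace.expSeries_div_hasSum_exp _
  have hexp (x : ℝ) : HasSum (fun k : ℕ => z ^ k / k ! * ((x ^ k : ℝ) : ℂ))
      (Complex.exp (z * (id x : ℝ))) := by
    have h : HasSum (fun k : ℕ => (z * x) ^ k / (k ! : ℂ)) (Complex.exp (z * x)) := by
      rw [Complex.exp_eq_exp_ℂ]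
      exact NormedSpace.expSeries_div_hasSum_exp _
    refine h.congr_fun fun k => ?_
    push_cast
    ring
  have h := hasSum_integral_of_dominated_convergence (μ := (μ : Measure ℝ))
    (F := fun (k : ℕ) (x : ℝ) => z ^ k / k ! * ((x ^ k : ℝ) : ℂ))
    (f := fun x : ℝ => Complex.exp (z * (id x : ℝ)))
    (fun k x => (‖z‖ * |x|) ^ k / k !) (fun k => by fun_prop)
    (fun k => ae_of_all _ fun x => ?_) (ae_of_all _ fun x => (hbound x).summable) ?_
    (ae_of_all _ hexp)
  · refine h.congr_fun fun k => ?_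
    rw [integral_const_mul, integral_complex_ofReal, (hμ k).2]
  · simp [mul_pow, div_mul_eq_mul_div]
  · simp only [(hbound _).tsum_eq]
    refine ((integrable_cosh_of_hasMoments hμ (hm ‖z‖)).const_mul 2).mono' (by fun_prop)
      (ae_of_all _ fun x => ?_)
    rw [Real.norm_eq_abs, Real.abs_exp, ← Real.cosh_abs, abs_mul, abs_norm, Real.cosh_eq]
    have := Real.exp_pos (-(‖z‖ * |x|))
    linarith

/-- A measure is determined by its moments if their exponential generating function is entire. -/
lemma eq_of_hasMoments {μ κ : ProbabilityMeasure ℝ} (hμ : HasMoments μ m) (hκ : HasMoments κ m)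
    (hm : ∀ t : ℝ, Summable fun k : ℕ => m k / k ! * t ^ k) : μ = κ := by
  refine Subtype.ext (Measure.ext_of_complexMGF_id_eq (μ := (μ : Measure ℝ))
    (μ' := (κ : Measure ℝ)) (funext fun z => ?_))
  exact (hasSum_complexMGF_of_hasMoments hμ hm z).unique (hasSum_complexMGF_of_hasMoments hκ hm z)

end Determinacy

/-! ### The Mittag-Leffler distribution -/

section MittagLeffler

/-- The part of Euler's integral over `(a, ∞)`, where `u ^ x ≥ a ^ x`, gives the lower bound. -/
lemma rpow_mul_exp_neg_le_Gamma {a x : ℝ} (ha : 0 < a) (hx : 0 ≤ x) :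
    a ^ x * Real.exp (-a) ≤ Real.Gamma (x + 1) := by
  have hint := Real.GammaIntegral_convergent (s := x + 1) (by positivity)
  rw [Real.Gamma_eq_integral (by positivity), ← integral_exp_neg_Ioi a, ← integral_const_mul]
  calc ∫ u in Set.Ioi a, a ^ x * Real.exp (-u)
      ≤ ∫ u in Set.Ioi a, Real.exp (-u) * u ^ (x + 1 - 1) := by
        refine setIntegral_mono_on ((integrableOn_exp_neg_Ioi a).const_mul _)
          (hint.mono_set (Set.Ioi_subset_Ioi ha.le)) measurableSet_Ioi fun u hu => ?_
        rw [add_sub_cancel_right, mul_comm]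
        gcongr
        exact (Set.mem_Ioi.1 hu).le
    _ ≤ ∫ u in Set.Ioi 0, Real.exp (-u) * u ^ (x + 1 - 1) := by
        refine setIntegral_mono_set hint ?_ (Set.Ioi_subset_Ioi ha.le).eventuallyLE
        filter_upwards [self_mem_ae_restrict measurableSet_Ioi] with u hu
        have hu : 0 < u := hu
        simp only [Pi.zero_apply]
        positivity

/-- The Mittag-Leffler function `∑ t ^ r / Γ(r p + 1)` is entire. -/
lemma summable_pow_div_Gamma {p : ℝ} (hp : 0 < p) (t : ℝ) :
    Summable fun r : ℕ => (r ! : ℝ) / Real.Gamma ((r : ℝ) * p + 1) / r ! * t ^ r := by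
  -- With `a ^ p = 2 (|t| + 1)`, the lower bound for the Gamma function yields a geometric series.
  set b : ℝ := 2 * (|t| + 1) with hb
  have hb0 : 0 < b := by positivity
  set a : ℝ := b ^ p⁻¹ with ha
  have ha0 : 0 < a := Real.rpow_pos_of_pos hb0 _
  refine Summable.of_norm_bounded
    ((summable_geometric_two).mul_left (Real.exp a)) fun r => ?_
  have hΓ : b ^ r * Real.exp (-a) ≤ Real.Gamma (r * p + 1) := by
    have h := rpow_mul_exp_neg_le_Gamma ha0 (mul_nonneg r.cast_nonneg hp.le)
    rwa [mul_comm (r : ℝ), Real.rpow_mul ha0.le, ha, Real.rpow_inv_rpow hb0.le hp.ne',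
      Real.rpow_natCast, ← ha, mul_comm p] at h
  have hΓ0 : 0 < Real.Gamma (r * p + 1) := lt_of_lt_of_le (by positivity) hΓ
  rw [norm_mul, norm_pow, Real.norm_eq_abs, Real.norm_eq_abs, div_right_comm,
    div_self (by positivity), abs_of_pos (by positivity), div_mul_eq_mul_div, one_mul,
    div_le_iff₀ hΓ0]
  calc |t| ^ r ≤ (b / 2) ^ r := by gcongr; rw [hb]; linarith
    _ = Real.exp a * (1 / 2) ^ r * (b ^ r * Real.exp (-a)) := by
        rw [Real.exp_neg, div_pow, div_pow, one_pow]
        field_simp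
    _ ≤ _ := by gcongr

lemma IsMittagLeffler.eq {p : ℝ} (hp : 0 < p) {μ κ : ProbabilityMeasure ℝ}
    (hμ : IsMittagLeffler p μ) (hκ : IsMittagLeffler p κ) : μ = κ :=
  eq_of_hasMoments hμ hκ (summable_pow_div_Gamma hp)

variable {p : ℝ} {hp : p ∈ Set.Ioo (0 : ℝ) 1} {v : Node}

/-- The law of `D_n / n^p`, where `D_n` is the degree of `v`. -/
noncomputable def scaledDegreeLaw (p : ℝ) (hp : p ∈ Set.Ioo (0 : ℝ) 1) (v : Node) (n : ℕ) :
    ProbabilityMeasure ℝ :=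
  ⟨(bernoulliModel p hp n).toMeasure.map (scaledDegree p v n),
    Measure.isProbabilityMeasure_map (measurable_scaledDegree n).aemeasurable⟩

lemma integrable_pow_scaledDegreeLaw (hv : v = Node.source ∨ v = Node.sink) (n r : ℕ) :
    Integrable (fun x : ℝ => x ^ r) (scaledDegreeLaw p hp v (n + 1) : Measure ℝ) :=
  (integrable_map_measure (by fun_prop : Continuous fun x : ℝ => x ^ r).aestronglyMeasurable
    (measurable_scaledDegree _).aemeasurable).2 (integrable_scaledDegree_pow hv (by simp) r)

lemma tendsto_moments_scaledDegreeLaw (hv : v = Node.source ∨ v = Node.sink) (r : ℕ) :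
    Tendsto (fun n => ∫ x, x ^ r ∂(scaledDegreeLaw p hp v (n + 1) : Measure ℝ)) atTop
      (𝓝 ((r ! : ℝ) / Real.Gamma ((r : ℝ) * p + 1))) := by
  refine ((tendsto_add_atTop_iff_nat 1).2
    (tendsto_integral_scaledDegree_pow (p := p) (hp := hp) hv r)).congr fun n => ?_
  exact (integral_map (measurable_scaledDegree _).aemeasurable
    (by fun_prop : Continuous fun x : ℝ => x ^ r).aestronglyMeasurable).symm

lemma tendsto_scaledDegreeLaw (hv : v = Node.source ∨ v = Node.sink) {μ : ProbabilityMeasure ℝ}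
    (hμ : IsMittagLeffler p μ) : Tendsto (scaledDegreeLaw p hp v) atTop (𝓝 μ) := by
  -- The shift avoids the empty network, whose degrees are not covered by the moment formulas.
  rw [← tendsto_add_atTop_iff_nat 1]
  exact tendsto_of_tendsto_moments (integrable_pow_scaledDegreeLaw hv)
    (tendsto_moments_scaledDegreeLaw hv) fun κ hκ => IsMittagLeffler.eq hp.1 hκ hμ

end MittagLeffler

theorem mainTheorem1 (p : ℝ) (hp : p ∈ Set.Ioo (0 : ℝ) 1) :
    (∀ v : Node, v = Node.source ∨ v = Node.sink → ∀ n : ℕ, 1 ≤ n →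
      (bernoulliModel p hp n).toMeasure.real {G | 1 ≤ G.degree v ∧ G.degree v ≤ n} = 1 ∧
      ∀ m : ℕ, 1 ≤ m → m ≤ n →
        (bernoulliModel p hp n).toMeasure.real {G | G.degree v = m} =
          ∑ j ∈ Finset.range m, ((m - 1).choose j : ℝ) * (-1 : ℝ) ^ (n + j - 1) *
            Ring.choose (p * ((j : ℝ) + 1) - 1) (n - 1)) ∧
    (∃! μ : ProbabilityMeasure ℝ, IsMittagLeffler p μ) ∧
    (∀ v : Node, v = Node.source ∨ v = Node.sink →
      ∀ μ : ProbabilityMeasure ℝ, IsMittagLeffler p μ →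
        TendstoInDistribution
          (fun (n : ℕ) (G : Network n) => (G.degree v : ℝ) / (n : ℝ) ^ p) atTop (fun x : ℝ => x)
          (fun n => (bernoulliModel p hp n).toMeasure) (μ : Measure ℝ)) := by
  refine ⟨fun v hv n hn => ⟨?_, fun m hm _ => ?_⟩, ?_, fun v hv μ hμ => ?_⟩
  · have h : (bernoulliModel p hp n).toMeasure {G | 1 ≤ G.degree v ∧ G.degree v ≤ n} = 1 :=
      (PMF.toMeasure_apply_eq_one_iff _ MeasurableSpace.measurableSet_top).2
        fun G hG => degree_mem_of_mem_support hv hn hG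
    rw [measureReal_def, h, ENNReal.toReal_one]
  · obtain ⟨n, rfl⟩ := Nat.exists_eq_add_of_le' hn
    obtain ⟨m, rfl⟩ := Nat.exists_eq_add_of_le' hm
    have h := degreeProb_eq_sum (p := p) (hp := hp) hv n m
    rw [degreeProb] at h
    rw [h]
    refine Finset.sum_congr rfl fun j _ => ?_
    rw [Nat.add_sub_cancel, Nat.add_sub_cancel, Nat.add_right_comm, Nat.add_sub_cancel]
  · obtain ⟨μ, hμ⟩ := exists_hasMoments_of_tendsto_moments
      (integrable_pow_scaledDegreeLaw (p := p) (hp := hp) (Or.inl rfl))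
      (tendsto_moments_scaledDegreeLaw (Or.inl rfl))
    exact ⟨μ, hμ, fun κ hκ => IsMittagLeffler.eq hp.1 hκ hμ⟩
  · refine ⟨fun n => (measurable_scaledDegree n).aemeasurable, aemeasurable_id', ?_⟩
    have h := tendsto_scaledDegreeLaw (hp := hp) hv hμ
    have hid : (⟨(μ : Measure ℝ).map fun x => x,
        Measure.isProbabilityMeasure_map aemeasurable_id'⟩ : ProbabilityMeasure ℝ) = μ :=
      Subtype.ext Measure.map_id'
    exact h.trans (congrArg (𝓝 : ProbabilityMeasure ℝ → _) hid.symm).le
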